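/- A clause is a finite set of literals, read as their disjunction ($\sqcup$ is the empty clause), and a CNF formula is a finite set of clauses; a formula is in 2CNF if each clause has at most two literals. A read-once resolution step replaces the current set of clauses $U$ by $(U\setminus\{\alpha\vee x,\ \neg x\vee\beta\})\cup\{\alpha\vee\beta\}$, where $\alpha\vee x,\ \neg x\vee\beta\in U$. A formula $\Phi$ is in ROR if a finite sequence of read-once resolution steps leads from $\Phi$ to a set of clauses containing $\sqcup$. A formula is minimal unsatisfiable (MU) if it is unsatisfiable and all its proper sub-formulas are satisfiable; MU$(1)$ is the set of MU formulas whose number of clauses minus number of occurring variables is $1$. For a formula $\Phi'=\{(x\vee\pi_1),\dots,(x\vee\pi_r),\sigma_1,\dots,\sigma_t,(\neg x\vee\phi_1),\dots,(\neg x\vee\phi_q)\}$ with $r,t,q\ge 0$, where neither $x$ nor $\neg x$ occurs in any $\sigma_i$ ($\Phi'$ itself is not required to be minimal unsatisfiable), a splitting of $\Phi'$ over $x$ is a pair $(F_x,F_{\neg x})$ of minimal unsatisfiable formulas $F_x=\{\pi_1,\dots,\pi_r\}\cup S$ and $F_{\neg x}=T\cup\{\phi_1,\dots,\phi_q\}$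 with $S,T\subseteq\{\sigma_1,\dots,\sigma_t\}$. It is disjunctive if $S$ and $T$ can be chosen with $S\cap T=\emptyset$. Theorem. Let $\Phi$ be a 2CNF formula that does not contain the empty clause. Then $\Phi\in$ ROR if and only if there exist a sub-formula $\Phi'\subseteq\Phi$, a variable $x$ and a disjunctive splitting $(F_x,F_{\neg x})$ of $\Phi'$ over $x$ such that $F_x$ and $F_{\neg x}$ are both in MU$(1)$. -/

import Mathlib

namespace ReadOnce

/-- A literal over the variables `V`: `(x, true)` is `x`, and `(x, false)` is `¬ x`. -/
abbrev Literal (V : Type*) := V × Bool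

/-- A clause is the disjunction of a finite set of literals; `∅` is the empty clause. -/
abbrev Clause (V : Type*) := Finset (Literal V)

/-- A formula in CNF is a finite set of clauses, read as their conjunction. -/
abbrev CNF (V : Type*) := Finset (Clause V)

variable {V : Type*}

/-- Every clause has at most two literals. -/
def Is2CNF (Φ : CNF V) : Prop := ∀ C ∈ Φ, C.card ≤ 2

/-- The assignment `τ` makes every clause of `Φ` true. -/
def Satisfies (τ : V → Bool) (Φ : CNF V) : Prop := ∀ C ∈ Φ, ∃ l ∈ C, τ l.1 = l.2

def Satisfiable (Φ : CNF V) : Prop := ∃ τ : V → Bool, Satisfies τ Φ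

/-- Minimal unsatisfiable formulas. -/
def MU (Φ : CNF V) : Prop := ¬ Satisfiable Φ ∧ ∀ Ψ : CNF V, Ψ ⊂ Φ → Satisfiable Ψ

variable [DecidableEq V]

/-- The variables that occur in `Φ`. -/
def vars (Φ : CNF V) : Finset V := Φ.biUnion fun C => C.image Prod.fst

/-- Number of clauses minus number of variables. -/
def deficiency (Φ : CNF V) : ℤ := (Φ.card : ℤ) - ((vars Φ).card : ℤ)

/-- Minimal unsatisfiable formulas of deficiency `k`. -/
def MUk (k : ℤ) (Φ : CNF V) : Prop := MU Φ ∧ deficiency Φ = k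

/-- `R` is the resolvent of `C = α ∨ x` and `D = ¬ x ∨ β`, that is `R = α ∨ β`. -/
def IsResolvent (x : V) (C D R : Clause V) : Prop :=
  (x, true) ∈ C ∧ (x, false) ∈ D ∧ R = C.erase (x, true) ∪ D.erase (x, false)

/-- A read-once resolution step on the current set of clauses: the two parent clauses are
deleted and the resolvent is added. -/
def ReadOnceStep (U U' : CNF V) : Prop :=
  ∃ (x : V) (C D R : Clause V), C ∈ U ∧ D ∈ U ∧ IsResolvent x C D R ∧ U' = (U \ {C, D}) ∪ {R}

/-- There is a read-once resolution derivation of the clause `C` from `Φ`. -/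
def ReadOnceDerives (Φ : CNF V) (C : Clause V) : Prop :=
  ∃ U : CNF V, Relation.ReflTransGen ReadOnceStep Φ U ∧ C ∈ U

/-- Formulas that have a read-once resolution refutation. -/
def ROR (Φ : CNF V) : Prop := ReadOnceDerives Φ ∅

/-- The clauses of `Φ` that contain the literal `l`, with `l` removed from each of them. -/
def stripped (Φ : CNF V) (l : Literal V) : CNF V :=
  (Φ.filter fun C => l ∈ C).image fun C => C.erase l

/-- The clauses of `Φ` in which neither `x` nor `¬ x` occurs. -/
def without (Φ : CNF V) (x : V) : CNF V :=
  Φ.filter fun C => (x, true) ∉ C ∧ (x, false) ∉ C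

/-- `(F, G)` is a splitting of `Φ` over `x`, in which `F` and `G` receive the sets `S` and `T` of
clauses of `Φ` without the variable `x`. The formula `Φ` itself may be any formula. -/
def IsSplittingWith (Φ : CNF V) (x : V) (S T F G : CNF V) : Prop :=
  S ⊆ without Φ x ∧ T ⊆ without Φ x ∧
  F = stripped Φ (x, true) ∪ S ∧ G = T ∪ stripped Φ (x, false) ∧
  MU F ∧ MU G

/-- `(F, G)` is a disjunctive splitting of `Φ` over `x`. -/
def IsDisjunctiveSplitting (Φ : CNF V) (x : V) (F G : CNF V) : Prop :=
  ∃ S T : CNF V, IsSplittingWith Φ x S T F G ∧ S ∩ T = ∅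

end ReadOnce

namespace ReadOnce

/-! A read-once refutation amounts to a resolution tree for `∅` whose leaves are pairwise distinct
clauses of the formula. A derivation unfolds into such a tree
(`ReadOnceDerives.exists_treeDerives`). The converse (`ror_of_treeDerives`) is delicate because
formulas are sets: a resolvent equal to a clause that is still needed merges with it, and one of two
required copies is lost. If the leaf multiset is minimal, exchanging subtrees always produces two
leaves whose resolvent is new.

From a splitting to a refutation: in a 2CNF formula in MU(1), counting yields a variable that occurs
in only two clauses, and resolving these stays inside MU(1); hence some tree uses every clause
exactly once (`MUk.treeDerives`). Putting `x` and `¬x` back into the trees of the two halves gives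
disjoint sets of leaves and roots `x` and `¬x`, unless one root is already `∅`.

From a refutation to a splitting: the last step resolves `x` with `¬x`, and the two subtrees have
disjoint leaves. In the implication graph of its leaves, the first subtree yields a walk from `¬x`
to `x`. This walk contains a lasso, a path with distinct variables that finally steps to the
complement of one of its literals. Stripped of `x`, the lasso has one clause more than variables and
lies in MU(1) (`chain_mUk_one`). The second subtree is treated alike. -/

variable {V : Type*} [DecidableEq V]

/-! ### Resolution trees and their leaves -/

/-- `R` is the resolvent of `C` and `D`, in one of the two orders, upon some variable. -/
def Resolves (C D R : Clause V) : Prop :=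
  ∃ x : V, IsResolvent x C D R ∨ IsResolvent x D C R

/-- There is a resolution tree with root `C` whose multiset of leaves is the given one. -/
inductive TreeDerives : Multiset (Clause V) → Clause V → Prop
  | leaf (C : Clause V) : TreeDerives {C} C
  | res {A B : Multiset (Clause V)} {C D R : Clause V} : TreeDerives A C → TreeDerives B D →
      Resolves C D R → TreeDerives (A + B) R

theorem Resolves.symm {C D R : Clause V} (h : Resolves C D R) : Resolves D C R := by
  obtain ⟨x, h⟩ := h
  exact ⟨x, h.symm⟩

/-- Each of the two erased literals survives in the other copy of the tautological clause. -/
theorem IsResolvent.eq_of_self {x : V} {C R : Clause V} (h : IsResolvent x C C R) : R = C := by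
  obtain ⟨-, -, rfl⟩ := h
  ext l
  simp only [Finset.mem_union, Finset.mem_erase]
  by_cases hl : l = (x, true)
  · subst hl; simp
  · tauto

theorem Resolves.eq_of_self {C R : Clause V} (h : Resolves C C R) : R = C := by
  obtain ⟨x, h | h⟩ := h <;> exact h.eq_of_self

namespace TreeDerives

theorem one_le_card {A : Multiset (Clause V)} {C : Clause V} (h : TreeDerives A C) :
    1 ≤ A.card := by
  induction h with
  | leaf C => simp
  | res _ _ _ h₁ h₂ => rw [Multiset.card_add]; omega

theorem eq_singleton {A : Multiset (Clause V)} {C : Clause V} (h : TreeDerives A C)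
    (hA : A.card ≤ 1) : A = {C} := by
  cases h with
  | leaf => rfl
  | res h₁ h₂ _ =>
    have := h₁.one_le_card
    have := h₂.one_le_card
    rw [Multiset.card_add] at hA
    omega

/-- A leaf of a resolution tree may be replaced by a tree with this root. -/
theorem substErase {A N : Multiset (Clause V)} {C M : Clause V} (hA : TreeDerives A M)
    (hN : TreeDerives N C) : M ∈ N → TreeDerives (A + N.erase M) C := by
  induction hN with
  | leaf C =>
    intro h
    rw [Multiset.mem_singleton] at h
    subst h
    simpa using hA
  | @res A₁ A₂ C D R h₁ h₂ hR ih₁ ih₂ =>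
    intro h
    by_cases hM : M ∈ A₁
    · rw [Multiset.erase_add_left_pos _ hM, ← add_assoc]
      exact (ih₁ hM).res h₂ hR
    · have hM₂ : M ∈ A₂ := (Multiset.mem_add.1 h).resolve_left hM
      rw [Multiset.erase_add_right_pos _ hM₂, add_left_comm]
      exact h₁.res (ih₂ hM₂) hR

theorem subst {A B : Multiset (Clause V)} {C M : Clause V} (hA : TreeDerives A M)
    (hB : TreeDerives (M ::ₘ B) C) : TreeDerives (A + B) C := by
  simpa using hA.substErase hB (Multiset.mem_cons_self M B)

theorem cons_res {A : Multiset (Clause V)} {C D R : Clause V} (h : TreeDerives A D)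
    (hR : Resolves C D R) : TreeDerives (C ::ₘ A) R := by
  rw [← Multiset.singleton_add]
  exact (TreeDerives.leaf C).res h hR

end TreeDerives

/-! ### Read-once derivations and trees with distinct leaves -/

/-- Two leaves of a resolution refutation with leaves `A` can be resolved into a clause that is
not among the leaves, in such a way that the refutation goes on from there. -/
def HasFreshStep (A : Multiset (Clause V)) : Prop :=
  ∃ (C D R : Clause V) (B : Multiset (Clause V)), A = C ::ₘ D ::ₘ B ∧ Resolves C D R ∧ R ∉ A ∧
    TreeDerives (R ::ₘ B) ∅

/-- Among the inner nodes that are not leaves there is one with fewer than `k` leaves below. -/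
def HasSmallNode (A : Multiset (Clause V)) (k : ℕ) : Prop :=
  ∃ (S B : Multiset (Clause V)) (M : Clause V), S + B = A ∧ TreeDerives S M ∧
    TreeDerives (M ::ₘ B) ∅ ∧ 2 ≤ S.card ∧ M ∉ A ∧ S.card < k

/-- If `C` is not a leaf, it is itself a smaller node. If it is a leaf of its own subtree, the rest
of that subtree is superfluous, against minimality. If it is a leaf outside the subtree of `M`, that
leaf and the subtree of `C` trade places, which leaves fewer leaves below `M`. -/
theorem hasSmallNode_or_mem {A A₁ A₂ B : Multiset (Clause V)} {C D M : Clause V}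
    (hmin : ∀ A' < A, ¬ TreeDerives A' ∅) (hA : A₁ + A₂ + B = A)
    (h₁ : TreeDerives A₁ C) (h₂ : TreeDerives A₂ D) (hM : Resolves C D M)
    (hB : TreeDerives (M ::ₘ B) ∅) (hMA : M ∉ A) (hc : 2 ≤ A₁.card) :
    HasSmallNode A (A₁.card + A₂.card) ∨ C ∈ A₂ := by
  have hc₂ := h₂.one_le_card
  have hCA₂ : TreeDerives (C ::ₘ A₂) M := h₂.cons_res hM
  have hC : TreeDerives (C ::ₘ (A₂ + B)) ∅ := by simpa using hCA₂.subst hB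
  by_cases hCA : C ∈ A
  · rw [← hA, Multiset.mem_add, Multiset.mem_add] at hCA
    rcases hCA with (hCA | hCA) | hCA
    · exfalso
      obtain ⟨A₁', rfl⟩ := Multiset.exists_cons_of_mem hCA
      refine hmin _ ?_ hC
      refine lt_of_le_of_ne ?_ ?_
      · rw [← hA, add_assoc, Multiset.cons_add]
        exact Multiset.cons_le_cons _ (Multiset.le_add_left _ _)
      · intro h
        have := congrArg Multiset.card (h.trans hA.symm)
        simp at this hc
        simp [this] at hc
    · exact Or.inr hCA
    · left
      obtain ⟨B', rfl⟩ := Multiset.exists_cons_of_mem hCA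
      refine ⟨C ::ₘ A₂, A₁ + B', M, ?_, hCA₂, ?_, ?_, hMA, ?_⟩
      · rw [← hA]
        simp only [← Multiset.singleton_add]
        abel
      · rw [Multiset.cons_swap] at hB
        simpa using h₁.subst hB
      · rw [Multiset.card_cons]; omega
      · rw [Multiset.card_cons]; omega
  · left
    exact ⟨A₁, A₂ + B, C, by rw [← hA, add_assoc], h₁, hC, hc, hCA, by omega⟩

/-- The open case of the exchange would be `D = C`, but then `M = C` is a leaf. -/
theorem hasSmallNode_or_hasFreshStep_of_leaf {A A₂ B : Multiset (Clause V)} {C D M : Clause V}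
    (hmin : ∀ A' < A, ¬ TreeDerives A' ∅) (hA : (C ::ₘ A₂) + B = A)
    (h₂ : TreeDerives A₂ D) (hM : Resolves C D M)
    (hB : TreeDerives (M ::ₘ B) ∅) (hMA : M ∉ A) :
    HasSmallNode A (A₂.card + 1) ∨ HasFreshStep A := by
  by_cases hc : 2 ≤ A₂.card
  · have h := hasSmallNode_or_mem (A₁ := A₂) (A₂ := {C}) hmin
      (by rw [← hA, ← Multiset.singleton_add, add_comm A₂]) h₂ (.leaf C) hM.symm hB hMA hc
    refine Or.inl (h.resolve_right fun hD => hMA ?_)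
    rw [Multiset.mem_singleton] at hD
    subst hD
    rw [hM.eq_of_self, ← hA]
    simp
  · right
    obtain rfl := h₂.eq_singleton (by omega)
    refine ⟨C, D, M, B, ?_, hM, hMA, hB⟩
    rw [← hA, Multiset.cons_add, Multiset.singleton_add]

theorem HasSmallNode.hasFreshStep {A : Multiset (Clause V)} (hmin : ∀ A' < A, ¬ TreeDerives A' ∅)
    (k : ℕ) : HasSmallNode A k → HasFreshStep A := by
  induction k using Nat.strong_induction_on with
  | _ k ih =>
  rintro ⟨S, B, M, hA, hS, hB, hc, hMA, hk⟩
  suffices h : HasSmallNode A S.card ∨ HasFreshStep A from h.elim (ih _ hk) id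
  cases hS with
  | leaf => simp at hc
  | @res A₁ A₂ C D _ h₁ h₂ hM =>
    by_cases hc₁ : 2 ≤ A₁.card
    · rw [Multiset.card_add]
      rcases hasSmallNode_or_mem hmin hA h₁ h₂ hM hB hMA hc₁ with h | h
      · exact Or.inl h
      -- The leaf `C` inside `A₂` and the subtree over `A₁` trade places: the parent `C` becomes a
      -- leaf, and the number of leaves below `M` is unchanged.
      · obtain ⟨A₂', rfl⟩ := Multiset.exists_cons_of_mem h
        have h₃ := hasSmallNode_or_hasFreshStep_of_leaf (A₂ := A₁ + A₂') hmin
          (by rw [← hA]; simp only [← Multiset.singleton_add]; abel) (h₁.subst h₂) hM hB hMA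
        simpa [add_assoc] using h₃
    · obtain rfl := h₁.eq_singleton (by omega)
      rw [Multiset.card_add, Multiset.card_singleton, add_comm]
      exact hasSmallNode_or_hasFreshStep_of_leaf hmin
        (by rw [← hA, Multiset.singleton_add]) h₂ hM hB hMA

theorem Resolves.readOnceStep {U : CNF V} {C D R : Clause V} (h : Resolves C D R) (hC : C ∈ U)
    (hD : D ∈ U) : ReadOnceStep U ((U \ {C, D}) ∪ {R}) := by
  obtain ⟨x, h | h⟩ := h
  · exact ⟨x, C, D, R, hC, hD, h, rfl⟩
  · exact ⟨x, D, C, R, hD, hC, h, by rw [Finset.pair_comm]⟩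

theorem ROR.of_step {U U' : CNF V} (h : ReadOnceStep U U') (h' : ROR U') : ROR U := by
  obtain ⟨W, hW, hm⟩ := h'
  exact ⟨W, hW.head h, hm⟩

/-- A resolution tree with pairwise distinct leaves gives a read-once refutation. -/
theorem ror_of_treeDerives (n : ℕ) : ∀ (U : CNF V) (A : Multiset (Clause V)), A.card = n →
    A.Nodup → (∀ C ∈ A, C ∈ U) → TreeDerives A ∅ → ROR U := by
  induction n using Nat.strong_induction_on with
  | _ n ih =>
  intro U A hn hA hAU h
  by_cases hmin : ∀ A' < A, ¬ TreeDerives A' ∅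
  · by_cases hc : 2 ≤ A.card
    · have hE : (∅ : Clause V) ∉ A := by
        intro hE
        refine hmin {∅} ?_ (.leaf ∅)
        refine lt_of_le_of_ne (Multiset.singleton_le.2 hE) ?_
        rintro rfl
        simp at hc
      -- The descent starts at the root `∅`, which by minimality is not a leaf.
      obtain ⟨C, D, R, B, rfl, hR, hRA, hB⟩ := HasSmallNode.hasFreshStep hmin (A.card + 1)
        ⟨A, 0, ∅, by simp, h, .leaf ∅, hc, hE, by omega⟩
      refine ROR.of_step (hR.readOnceStep (hAU C (by simp)) (hAU D (by simp)))
        (ih (B.card + 1) (by simp at hn; omega) _ (R ::ₘ B) (by simp) ?_ ?_ hB)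
      · simp only [Multiset.nodup_cons, Multiset.mem_cons, not_or] at hA hRA ⊢
        exact ⟨hRA.2.2, hA.2.2⟩
      · intro E hm
        simp only [Multiset.nodup_cons, Multiset.mem_cons, not_or] at hA hm
        rcases hm with rfl | hm
        · simp
        · simp only [Finset.mem_union, Finset.mem_sdiff, Finset.mem_insert, Finset.mem_singleton,
            not_or]
          refine Or.inl ⟨hAU E (by simp [hm]), ?_, ?_⟩
          · rintro rfl; exact hA.1.2 hm
          · rintro rfl; exact hA.2.1 hm
    · obtain rfl := h.eq_singleton (by omega)
      exact ⟨U, .refl, hAU ∅ (by simp)⟩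
  · push Not at hmin
    obtain ⟨A', hlt, h'⟩ := hmin
    exact ih A'.card (hn ▸ Multiset.card_lt_card hlt) U A' rfl (Multiset.nodup_of_le hlt.le hA)
      (fun C hC => hAU C (Multiset.mem_of_le hlt.le hC)) h'

/-- Backwards along the derivation, a leaf equal to the resolvent is expanded into its parents. The
leaves stay distinct because the step has deleted the parents, so no other leaf equals one of them.
-/
theorem ReadOnceDerives.exists_treeDerives {Φ : CNF V} {C : Clause V} (h : ReadOnceDerives Φ C) :
    ∃ A : CNF V, A ⊆ Φ ∧ TreeDerives A.val C := by
  obtain ⟨U, hU, hC⟩ := h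
  induction hU using Relation.ReflTransGen.head_induction_on with
  | refl => exact ⟨{C}, by simpa using hC, .leaf C⟩
  | @head U₁ U₂ hstep _ ih =>
    obtain ⟨A, hA, hT⟩ := ih
    obtain ⟨x, C, D, R, hC, hD, hR, rfl⟩ := hstep
    by_cases hRA : R ∈ A
    · by_cases hCD : C = D
      · subst hCD
        obtain rfl := hR.eq_of_self
        refine ⟨A, hA.trans ?_, hT⟩
        intro E hE
        simp only [Finset.mem_union, Finset.mem_sdiff, Finset.mem_singleton] at hE
        rcases hE with hE | rfl
        · exact hE.1
        · exact hC
      · have hsub : ∀ E ∈ A.erase R, E ∈ U₁ ∧ E ≠ C ∧ E ≠ D := by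
          intro E hE
          have := hA (Finset.mem_of_mem_erase hE)
          have hne := Finset.ne_of_mem_erase hE
          simpa [hne] using this
        have hD' : D ∉ A.erase R := fun h => (hsub D h).2.2 rfl
        have hC' : C ∉ (A.erase R).cons D hD' := by
          simp only [Finset.mem_cons, not_or]
          exact ⟨hCD, fun h => (hsub C h).2.1 rfl⟩
        refine ⟨((A.erase R).cons D hD').cons C hC', ?_, ?_⟩
        · intro E hE
          simp only [Finset.mem_cons] at hE
          rcases hE with rfl | rfl | hE
          · exact hC
          · exact hD
          · exact (hsub E hE).1
        · have h := TreeDerives.substErase ((TreeDerives.leaf C).res (.leaf D) ⟨x, Or.inl hR⟩) hT hRA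
          rw [Finset.cons_val, Finset.cons_val, Finset.erase_val, ← Multiset.singleton_add,
            ← Multiset.singleton_add, ← add_assoc]
          exact h
    · refine ⟨A, fun E hE => ?_, hT⟩
      have := hA hE
      simp only [Finset.mem_union, Finset.mem_sdiff, Finset.mem_singleton] at this
      rcases this with h | rfl
      · exact h.1
      · exact absurd hE hRA

/-! ### Minimal unsatisfiable 2CNF formulas of deficiency 1 -/

theorem Satisfies.mono {V : Type*} {τ : V → Bool} {Φ Ψ : CNF V} (h : Satisfies τ Φ) (hs : Ψ ⊆ Φ) :
    Satisfies τ Ψ := fun C hC => h C (hs hC)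

theorem MU.satisfiable_erase {F : CNF V} (hF : MU F) {C : Clause V} (hC : C ∈ F) :
    Satisfiable (F.erase C) := hF.2 _ (Finset.erase_ssubset hC)

theorem MU.eq_of_subset {F G : CNF V} (hF : MU F) (hG : ¬ Satisfiable G) (h : G ⊆ F) : G = F := by
  by_contra hne
  exact hG (hF.2 G (Finset.ssubset_iff_subset_ne.2 ⟨h, hne⟩))

theorem MU.tautology_free {F : CNF V} (hF : MU F) {C : Clause V} (hC : C ∈ F) {v : V}
    (ht : (v, true) ∈ C) : (v, false) ∉ C := by
  intro hf
  obtain ⟨τ, hτ⟩ := hF.satisfiable_erase hC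
  refine hF.1 ⟨τ, fun D hD => ?_⟩
  by_cases hDC : D = C
  · subst hDC
    cases h : τ v
    · exact ⟨_, hf, h⟩
    · exact ⟨_, ht, h⟩
  · exact hτ D (Finset.mem_erase.2 ⟨hDC, hD⟩)

/-- In a minimal unsatisfiable formula no literal is pure. -/
theorem MU.exists_neg_mem {F : CNF V} (hF : MU F) {C : Clause V} (hC : C ∈ F) {v : V} {b : Bool}
    (hv : (v, b) ∈ C) : ∃ D ∈ F, (v, !b) ∈ D := by
  by_contra! hno
  obtain ⟨τ, hτ⟩ := hF.satisfiable_erase hC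
  refine hF.1 ⟨Function.update τ v b, fun D hD => ?_⟩
  by_cases hDC : D = C
  · subst hDC
    exact ⟨_, hv, by simp⟩
  · obtain ⟨⟨w, c⟩, hl, h⟩ := hτ D (Finset.mem_erase.2 ⟨hDC, hD⟩)
    refine ⟨_, hl, ?_⟩
    by_cases hw : w = v
    · subst hw
      have : c ≠ !b := fun h => hno D hD (h ▸ hl)
      simp only [Function.update_self]
      revert this
      cases b <;> cases c <;> simp
    · simpa [hw] using h

theorem mem_vars {Φ : CNF V} {v : V} : v ∈ vars Φ ↔ ∃ C ∈ Φ, ∃ b, (v, b) ∈ C := by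
  simp [vars]

theorem mem_image_fst {C : Clause V} {v : V} : v ∈ C.image Prod.fst ↔ ∃ b, (v, b) ∈ C := by
  simp

/-- A minimal unsatisfiable formula in 2CNF of deficiency 1 has a variable that occurs exactly
twice. -/
theorem exists_var_occurring_twice {F : CNF V} (hF : MU F) (h2 : Is2CNF F)
    (hd : F.card = (vars F).card + 1) (hE : ∅ ∉ F) :
    ∃ v ∈ vars F, (F.filter fun C => v ∈ C.image Prod.fst).card ≤ 2 := by
  by_contra! hno
  replace hno : ∀ v ∈ vars F, 3 ≤ (F.filter fun C => v ∈ C.image Prod.fst).card := hno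
  have hsum : ∑ v ∈ vars F, (F.filter fun C => v ∈ C.image Prod.fst).card ≤ 2 * F.card := by
    have := Finset.sum_card_bipartiteAbove_eq_sum_card_bipartiteBelow (s := vars F) (t := F)
      (fun v C => v ∈ C.image Prod.fst)
    simp only [Finset.bipartiteAbove, Finset.bipartiteBelow] at this
    rw [this, mul_comm, ← smul_eq_mul]
    refine Finset.sum_le_card_nsmul _ _ _ fun C hC => ?_
    refine le_trans (Finset.card_le_card (t := C.image Prod.fst) ?_)
      (Finset.card_image_le.trans (h2 C hC))
    intro v hv
    exact (Finset.mem_filter.1 hv).2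
  have hge : 3 * (vars F).card ≤ 2 * F.card := by
    refine le_trans ?_ hsum
    rw [mul_comm, ← smul_eq_mul]
    exact Finset.card_nsmul_le_sum _ _ _ fun v hv => hno v hv
  have hne : F.Nonempty := by
    rw [← Finset.card_pos]; omega
  obtain ⟨C₀, hC₀⟩ := hne
  obtain ⟨⟨v, b₀⟩, hl₀⟩ := Finset.nonempty_iff_ne_empty.2 fun h => hE (h ▸ hC₀)
  have hv : v ∈ vars F := mem_vars.2 ⟨C₀, hC₀, b₀, hl₀⟩
  -- With `n` variables and `n + 1` clauses, `3 * n ≤ 2 * (n + 1)` forces `n ≤ 2`. Three occurrences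
  -- among at most three clauses put every variable in every clause.
  have hF3 : F.card ≤ 3 := by omega
  have hall : ∀ w ∈ vars F, ∀ C ∈ F, ∃ b, (w, b) ∈ C := by
    intro w hw C hC
    have h := Finset.eq_of_subset_of_card_le
      (Finset.filter_subset (fun C => w ∈ C.image Prod.fst) F) (hF3.trans (hno w hw))
    rw [← h] at hC
    exact mem_image_fst.1 (Finset.mem_filter.1 hC).2
  have h3 : F.card = 3 := le_antisymm hF3 ((hno v hv).trans (Finset.card_filter_le _ _))
  obtain ⟨w, hw, hwv⟩ : ∃ w ∈ vars F, w ≠ v :=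
    Finset.exists_mem_ne (by omega) v
  -- one polarity of `v` occurs only once
  obtain ⟨b, C, hC, hone⟩ : ∃ b, ∃ C ∈ F, ∀ D ∈ F, D ≠ C → (v, !b) ∈ D := by
    have key : ∀ b, (F.filter fun C => (v, b) ∈ C).card ≤ 1 →
        ∃ b, ∃ C ∈ F, ∀ D ∈ F, D ≠ C → (v, !b) ∈ D := by
      intro b hb
      obtain ⟨C, hC, hvC⟩ : ∃ C ∈ F, (v, b) ∈ C := by
        obtain ⟨c, hc⟩ := hall v hv C₀ hC₀
        by_cases hcb : c = b
        · exact ⟨C₀, hC₀, hcb ▸ hc⟩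
        · obtain ⟨D, hD, h⟩ := hF.exists_neg_mem hC₀ hc
          have : (!c) = b := by revert hcb; cases c <;> cases b <;> simp
          exact ⟨D, hD, this ▸ h⟩
      refine ⟨b, C, hC, fun D hD hDC => ?_⟩
      obtain ⟨c, hc⟩ := hall v hv D hD
      have hcb : c ≠ b := by
        rintro rfl
        exact hDC (Finset.card_le_one.1 hb D (by simp [hD, hc]) C (by simp [hC, hvC]))
      have : c = !b := by revert hcb; cases c <;> cases b <;> simp
      exact this ▸ hc
    have hsplit : (F.filter fun C => (v, true) ∈ C).card + (F.filter fun C => (v, false) ∈ C).card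
        ≤ 3 := by
      rw [← h3, ← Finset.card_union_of_disjoint]
      · exact Finset.card_le_card
          (Finset.union_subset (Finset.filter_subset _ _) (Finset.filter_subset _ _))
      · rw [Finset.disjoint_filter]
        exact fun C hC ht => hF.tautology_free hC ht
    rcases le_or_gt (F.filter fun C => (v, true) ∈ C).card 1 with h | h
    · exact key _ h
    · exact key false (by omega)
  -- The value of `v` satisfies all clauses but `C`, and `w` is free to satisfy `C`.
  obtain ⟨c, hc⟩ := hall w hw C hC
  refine hF.1 ⟨Function.update (fun _ => c) v (!b), fun D hD => ?_⟩
  by_cases hDC : D = C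
  · subst hDC
    exact ⟨_, hc, by simp [hwv]⟩
  · exact ⟨_, hone D hD hDC, by simp⟩

theorem MUk.card_eq {F : CNF V} (h : MUk 1 F) : F.card = (vars F).card + 1 := by
  have := h.2
  unfold deficiency at this
  omega

/-- A minimal unsatisfiable 2CNF formula of deficiency 1 has a resolution that uses every clause
once. -/
theorem MUk.treeDerives (n : ℕ) : ∀ F : CNF V, F.card = n → MUk 1 F → Is2CNF F →
    TreeDerives F.val ∅ := by
  induction n using Nat.strong_induction_on with
  | _ n ih =>
  intro F hn hF1 h2
  have hF := hF1.1
  by_cases hE : ∅ ∈ F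
  · have : ({∅} : CNF V) = F := hF.eq_of_subset
      (fun ⟨τ, hτ⟩ => by obtain ⟨l, hl, -⟩ := hτ ∅ (by simp); simp at hl) (by simpa using hE)
    rw [← this]
    exact .leaf ∅
  -- Resolving the only two clauses with `v` removes one clause and one variable, so the deficiency
  -- stays 1.
  obtain ⟨v, hv, hle⟩ := exists_var_occurring_twice hF h2 hF1.card_eq hE
  obtain ⟨C, D, hC, hD, hvC, hvD⟩ : ∃ C D, C ∈ F ∧ D ∈ F ∧ (v, true) ∈ C ∧ (v, false) ∈ D := by
    obtain ⟨C, hC, b, hb⟩ := mem_vars.1 hv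
    obtain ⟨D, hD, hb'⟩ := hF.exists_neg_mem hC hb
    cases b
    · exact ⟨D, C, hD, hC, hb', hb⟩
    · exact ⟨C, D, hC, hD, hb, hb'⟩
  have hvC' := hF.tautology_free hC hvC
  have hvD' : (v, true) ∉ D := fun h => hF.tautology_free hD h hvD
  have hCD : C ≠ D := by rintro rfl; exact hvC' hvD
  have honly : ∀ E ∈ F, ∀ b, (v, b) ∈ E → E = C ∨ E = D := by
    intro E hE b hb
    have hsub : ({C, D} : CNF V) ⊆ F.filter fun C => v ∈ C.image Prod.fst := by
      intro E' hE'
      simp only [Finset.mem_insert, Finset.mem_singleton] at hE'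
      rw [Finset.mem_filter, mem_image_fst]
      rcases hE' with rfl | rfl
      · exact ⟨hC, _, hvC⟩
      · exact ⟨hD, _, hvD⟩
    have heq := Finset.eq_of_subset_of_card_le hsub (by rwa [Finset.card_pair hCD])
    have : E ∈ F.filter fun C => v ∈ C.image Prod.fst :=
      Finset.mem_filter.2 ⟨hE, mem_image_fst.2 ⟨b, hb⟩⟩
    rw [← heq] at this
    simpa using this
  set R : Clause V := C.erase (v, true) ∪ D.erase (v, false) with hRdef
  have hvR : ∀ b, (v, b) ∉ R := by
    intro b
    cases b <;> simp [hRdef, hvC', hvD']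
  set W : CNF V := (F.erase C).erase D with hW
  have hWF : W ⊆ F := (Finset.erase_subset _ _).trans (Finset.erase_subset _ _)
  have hvW : ∀ E ∈ W, ∀ b, (v, b) ∉ E := by
    intro E hE b hb
    simp only [hW, Finset.mem_erase] at hE
    rcases honly E hE.2.2 b hb with h | h
    · exact hE.2.1 h
    · exact hE.1 h
  have hFW : ∀ E ∈ F, E = C ∨ E = D ∨ E ∈ W := by
    intro E hE
    simp only [hW, Finset.mem_erase]
    tauto
  -- an assignment satisfying the resolvent extends to the parents
  have hext : ¬ Satisfiable (insert R W) := by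
    rintro ⟨τ, hτ⟩
    obtain ⟨⟨w, c⟩, hl, hτl⟩ := hτ R (by simp)
    have hwv : w ≠ v := by rintro rfl; exact hvR c hl
    have hWs : ∀ b, ∀ E ∈ W, ∃ l ∈ E, Function.update τ v b l.1 = l.2 := by
      intro b E hE
      obtain ⟨⟨u, d⟩, hl', h'⟩ := hτ E (by simp [hE])
      have : u ≠ v := by rintro rfl; exact hvW E hE d hl'
      exact ⟨_, hl', by simpa [this] using h'⟩
    rcases Finset.mem_union.1 hl with h | h
    · refine hF.1 ⟨Function.update τ v false, fun E hE => ?_⟩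
      rcases hFW E hE with rfl | rfl | hE
      · exact ⟨_, Finset.mem_of_mem_erase h, by simpa [hwv] using hτl⟩
      · exact ⟨_, hvD, by simp⟩
      · exact hWs _ E hE
    · refine hF.1 ⟨Function.update τ v true, fun E hE => ?_⟩
      rcases hFW E hE with rfl | rfl | hE
      · exact ⟨_, hvC, by simp⟩
      · exact ⟨_, Finset.mem_of_mem_erase h, by simpa [hwv] using hτl⟩
      · exact hWs _ E hE
  have hWsat : Satisfiable W :=
    hF.2 _ (lt_of_le_of_lt (Finset.erase_subset _ _) (Finset.erase_ssubset hC))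
  have hRW : R ∉ W := fun h => hext (by rwa [Finset.insert_eq_of_mem h])
  have hMU : MU (insert R W) := by
    refine ⟨hext, fun Ψ hΨ => ?_⟩
    obtain ⟨E, hE, hΨE⟩ := Finset.ssubset_iff_exists_subset_erase.1 hΨ
    by_cases hER : E = R
    · subst hER
      rw [Finset.erase_insert hRW] at hΨE
      obtain ⟨τ, hτ⟩ := hWsat
      exact ⟨τ, hτ.mono hΨE⟩
    · have hEW : E ∈ W := (Finset.mem_insert.1 hE).resolve_left hER
      have hEC : E ≠ C ∧ E ≠ D := by
        simp only [hW, Finset.mem_erase] at hEW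
        exact ⟨hEW.2.1, hEW.1⟩
      obtain ⟨τ, hτ⟩ := hF.satisfiable_erase (hWF hEW)
      refine ⟨τ, fun G hG => ?_⟩
      have hG' := Finset.mem_erase.1 (hΨE hG)
      rcases Finset.mem_insert.1 hG'.2 with rfl | hGW
      · obtain ⟨⟨w₁, c₁⟩, hl₁, h₁⟩ := hτ C (Finset.mem_erase.2 ⟨hEC.1.symm, hC⟩)
        obtain ⟨⟨w₂, c₂⟩, hl₂, h₂⟩ := hτ D (Finset.mem_erase.2 ⟨hEC.2.symm, hD⟩)
        by_cases hx : τ v = true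
        · refine ⟨(w₂, c₂), Finset.mem_union_right _ (Finset.mem_erase.2 ⟨?_, hl₂⟩), h₂⟩
          intro h
          obtain ⟨rfl, rfl⟩ := Prod.mk.inj h
          simp_all
        · refine ⟨(w₁, c₁), Finset.mem_union_left _ (Finset.mem_erase.2 ⟨?_, hl₁⟩), h₁⟩
          intro h
          obtain ⟨rfl, rfl⟩ := Prod.mk.inj h
          simp_all
      · exact hτ G (Finset.mem_erase.2 ⟨hG'.1, hWF hGW⟩)
  have hDC : D ∈ F.erase C := Finset.mem_erase.2 ⟨hCD.symm, hD⟩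
  have hcardW : W.card + 2 = F.card := by
    rw [← Finset.card_erase_add_one hC, ← Finset.card_erase_add_one hDC]
  have hvars : vars (insert R W) = (vars F).erase v := by
    ext w
    simp only [Finset.mem_erase, mem_vars]
    constructor
    · rintro ⟨E, hE, b, hb⟩
      rcases Finset.mem_insert.1 hE with rfl | hEW
      · refine ⟨by rintro rfl; exact hvR b hb, ?_⟩
        rcases Finset.mem_union.1 hb with h | h
        · exact ⟨C, hC, b, Finset.mem_of_mem_erase h⟩
        · exact ⟨D, hD, b, Finset.mem_of_mem_erase h⟩
      · exact ⟨by rintro rfl; exact hvW E hEW b hb, E, hWF hEW, b, hb⟩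
    · rintro ⟨hwv, E, hE, b, hb⟩
      rcases hFW E hE with rfl | rfl | hE
      · exact ⟨R, by simp, b, by simp [hRdef, hwv, hb]⟩
      · exact ⟨R, by simp, b, by simp [hRdef, hwv, hb]⟩
      · exact ⟨E, by simp [hE], b, hb⟩
  have hcard : (insert R W).card = W.card + 1 := Finset.card_insert_of_notMem hRW
  have hMU1 : MUk 1 (insert R W) := by
    refine ⟨hMU, ?_⟩
    have := hF1.card_eq
    have := Finset.card_erase_add_one hv
    unfold deficiency
    rw [hvars]
    omega
  have h2' : Is2CNF (insert R W) := by
    intro E hE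
    rcases Finset.mem_insert.1 hE with rfl | hE
    · have h₁ := h2 C hC
      have h₂ := h2 D hD
      rw [← Finset.card_erase_add_one hvC] at h₁
      rw [← Finset.card_erase_add_one hvD] at h₂
      exact (Finset.card_union_le _ _).trans (by omega)
    · exact h2 E (hWF hE)
  have hT := ih (insert R W).card (by omega) _ rfl hMU1 h2'
  rw [Finset.insert_val_of_notMem hRW] at hT
  have := ((TreeDerives.leaf C).res (.leaf D) ⟨v, Or.inl ⟨hvC, hvD, rfl⟩⟩).subst hT
  rw [hW, Finset.erase_val, Finset.erase_val, add_assoc, Multiset.singleton_add,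
    Multiset.singleton_add, Multiset.cons_erase (show D ∈ F.val.erase C from hDC),
    Multiset.cons_erase (by simpa using hC)] at this
  exact this

/-! ### From a disjunctive splitting to a refutation -/

/-- If `l` is a pivot literal, the parent that loses it already contains it; only the other parent
can gain `l`, and it passes `l` on to the resolvent. -/
theorem IsResolvent.lift {x : V} {C D R C' D' : Clause V} (l : Literal V)
    (h : IsResolvent x C D R) (hC : C' = C ∨ C' = insert l C) (hD : D' = D ∨ D' = insert l D) :
    ∃ R', (R' = R ∨ R' = insert l R) ∧ IsResolvent x C' D' R' := by
  obtain ⟨h₁, h₂, rfl⟩ := h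
  refine ⟨_, ?_, ?_, ?_, rfl⟩
  · by_cases ht : l = (x, true)
    · subst ht
      rw [Finset.insert_eq_of_mem h₁, or_self] at hC
      subst hC
      rcases hD with rfl | rfl
      · exact Or.inl rfl
      · right
        rw [Finset.erase_insert_of_ne (by simp), Finset.union_insert]
    · by_cases hf : l = (x, false)
      · subst hf
        rw [Finset.insert_eq_of_mem h₂, or_self] at hD
        subst hD
        rcases hC with rfl | rfl
        · exact Or.inl rfl
        · right
          rw [Finset.erase_insert_of_ne (by simp), Finset.insert_union]
      · rcases hC with rfl | rfl <;> rcases hD with rfl | rfl <;>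
          simp [Finset.erase_insert_of_ne, ht, hf]
  · rcases hC with rfl | rfl <;> simp [h₁]
  · rcases hD with rfl | rfl <;> simp [h₂]

/-- A resolution tree remains one when a literal is added to some of its leaves. -/
theorem TreeDerives.lift {A : Multiset (Clause V)} {C : Clause V} (h : TreeDerives A C)
    (l : Literal V) (f : Clause V → Clause V) : (∀ E ∈ A, f E = E ∨ f E = insert l E) →
    ∃ C', (C' = C ∨ C' = insert l C) ∧ TreeDerives (A.map f) C' := by
  induction h with
  | leaf C =>
    intro hf
    exact ⟨f C, hf C (by simp), by simpa using TreeDerives.leaf (f C)⟩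
  | @res A B C D R _ _ hR ih₁ ih₂ =>
    intro hf
    obtain ⟨C', hC', h₁⟩ := ih₁ fun E hE => hf E (Multiset.mem_add.2 (Or.inl hE))
    obtain ⟨D', hD', h₂⟩ := ih₂ fun E hE => hf E (Multiset.mem_add.2 (Or.inr hE))
    rw [Multiset.map_add]
    obtain ⟨x, hR | hR⟩ := hR
    · obtain ⟨R', hR', h⟩ := hR.lift l hC' hD'
      exact ⟨R', hR', h₁.res h₂ ⟨x, Or.inl h⟩⟩
    · obtain ⟨R', hR', h⟩ := hR.lift l hD' hC'
      exact ⟨R', hR', h₁.res h₂ ⟨x, Or.inr h⟩⟩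

/-- A refutation of the clauses that contain `l`, stripped of `l`, and of the clauses `S`, comes
from a tree with root `∅` or `{l}` over the original clauses. -/
theorem exists_treeDerives_of_stripped {Φ S : CNF V} {l : Literal V}
    (hl : ∀ C ∈ S, l ∉ C) (h : TreeDerives (stripped Φ l ∪ S).val ∅) :
    ∃ A : CNF V, (∀ C ∈ A, C ∈ S ∨ C ∈ Φ ∧ l ∈ C) ∧
      (TreeDerives A.val ∅ ∨ TreeDerives A.val {l}) := by
  have hlF : ∀ C ∈ stripped Φ l ∪ S, l ∉ C := by
    intro C hC
    rcases Finset.mem_union.1 hC with h | h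
    · obtain ⟨D, -, rfl⟩ := Finset.mem_image.1 h
      exact Finset.notMem_erase _ _
    · exact hl C h
  -- A clause that lies both in `S` and among the stripped clauses is taken from `S`. Erasing `l`
  -- undoes `f`, so the lifted leaves remain distinct.
  let f : Clause V → Clause V := fun C => if C ∈ S then C else insert l C
  have hf : ∀ C, f C = C ∨ f C = insert l C := by
    intro C
    by_cases hC : C ∈ S <;> simp [f, hC]
  have hfe : ∀ C ∈ stripped Φ l ∪ S, (f C).erase l = C := by
    intro C hC
    rcases hf C with h | h <;> rw [h]
    · exact Finset.erase_eq_of_notMem (hlF C hC)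
    · exact Finset.erase_insert (hlF C hC)
  have hinj : Set.InjOn f (stripped Φ l ∪ S : CNF V) := by
    intro C hC D hD h
    rw [← hfe C hC, ← hfe D hD, h]
  obtain ⟨C', hC', hT⟩ := h.lift l f fun C _ => hf C
  refine ⟨(stripped Φ l ∪ S).image f, ?_, ?_⟩
  · intro C hC
    obtain ⟨D, hD, rfl⟩ := Finset.mem_image.1 hC
    by_cases hDS : D ∈ S
    · simp [f, hDS]
    · right
      obtain ⟨E, hE, rfl⟩ := Finset.mem_image.1 ((Finset.mem_union.1 hD).resolve_right hDS)
      have hE' := Finset.mem_filter.1 hE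
      simpa [f, hDS, Finset.insert_erase hE'.2] using hE'
  · rw [Finset.image_val_of_injOn hinj]
    rcases hC' with rfl | rfl
    · exact Or.inl hT
    · exact Or.inr (by simpa using hT)

theorem is2CNF_stripped_union {Φ S : CNF V} {l : Literal V} (h2 : Is2CNF Φ) (hS : S ⊆ Φ) :
    Is2CNF (stripped Φ l ∪ S) := by
  intro C hC
  rcases Finset.mem_union.1 hC with h | h
  · obtain ⟨D, hD, rfl⟩ := Finset.mem_image.1 h
    exact (Finset.card_erase_le).trans (h2 D (Finset.mem_filter.1 hD).1)
  · exact h2 C (hS h)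

theorem ror_of_disjunctive_splitting {Φ Φ' F G : CNF V} (h2 : Is2CNF Φ) (hsub : Φ' ⊆ Φ) {x : V}
    (h : IsDisjunctiveSplitting Φ' x F G) (hF : MUk 1 F) (hG : MUk 1 G) : ROR Φ := by
  obtain ⟨S, T, ⟨hS, hT, rfl, rfl, -, -⟩, hST⟩ := h
  rw [Finset.union_comm T] at hG
  have h2' : Is2CNF Φ' := fun C hC => h2 C (hsub hC)
  have hw : ∀ C ∈ without Φ' x, C ∈ Φ' ∧ (x, true) ∉ C ∧ (x, false) ∉ C :=
    fun C hC => Finset.mem_filter.1 hC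
  have hSΦ : S ⊆ Φ' := fun C hC => (hw C (hS hC)).1
  have hTΦ : T ⊆ Φ' := fun C hC => (hw C (hT hC)).1
  obtain ⟨A, hA, hA'⟩ := exists_treeDerives_of_stripped (fun C hC => (hw C (hS hC)).2.1)
    (MUk.treeDerives _ _ rfl hF (is2CNF_stripped_union h2' hSΦ))
  obtain ⟨B, hB, hB'⟩ := exists_treeDerives_of_stripped (fun C hC => (hw C (hT hC)).2.2)
    (MUk.treeDerives _ _ rfl hG (is2CNF_stripped_union h2' hTΦ))
  have hAΦ : ∀ C ∈ A, C ∈ Φ := fun C hC => hsub ((hA C hC).elim (hSΦ ·) (·.1))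
  have hBΦ : ∀ C ∈ B, C ∈ Φ := fun C hC => hsub ((hB C hC).elim (hTΦ ·) (·.1))
  rcases hA' with hA' | hA'
  · exact ror_of_treeDerives _ Φ A.val rfl A.nodup hAΦ hA'
  rcases hB' with hB' | hB'
  · exact ror_of_treeDerives _ Φ B.val rfl B.nodup hBΦ hB'
  refine ror_of_treeDerives _ Φ (A.val + B.val) rfl ?_ ?_
    (hA'.res hB' ⟨x, Or.inl ⟨by simp, by simp, by simp⟩⟩)
  · refine Multiset.nodup_add.2 ⟨A.nodup, B.nodup, ?_⟩
    rw [Multiset.disjoint_left]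
    intro C hCA hCB
    rcases hA C hCA with hCS | ⟨hC, hx⟩ <;> rcases hB C hCB with hCT | ⟨-, hx'⟩
    · have : C ∈ S ∩ T := Finset.mem_inter.2 ⟨hCS, hCT⟩
      simp [hST] at this
    · exact (hw C (hS hCS)).2.2 hx'
    · exact (hw C (hT hCT)).2.1 hx
    -- A common clause containing both `x` and `¬x` would make `¬x` a pure literal of `F`.
    · have hmem : C.erase (x, true) ∈ stripped Φ' (x, true) ∪ S :=
        Finset.mem_union_left _ (Finset.mem_image_of_mem _ (Finset.mem_filter.2 ⟨hC, hx⟩))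
      obtain ⟨D, hD, hxD⟩ := hF.1.exists_neg_mem (v := x) (b := false) hmem (by simp [hx'])
      rcases Finset.mem_union.1 hD with h | h
      · obtain ⟨E, -, rfl⟩ := Finset.mem_image.1 h
        simp at hxD
      · exact (hw D (hS h)).2.1 hxD
  · intro C hC
    rcases Multiset.mem_add.1 hC with h | h
    · exact hAΦ C h
    · exact hBΦ C h

/-! ### Chains of implications -/

/-- The complementary literal. -/
def neg (l : Literal V) : Literal V := (l.1, !l.2)

omit [DecidableEq V] in
@[simp] theorem neg_neg (l : Literal V) : neg (neg l) = l := by simp [neg]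

/-- The clauses `P ∨ l₁, ¬ l₁ ∨ l₂, …, ¬ lₙ₋₁ ∨ lₙ, ¬ lₙ ∨ E` for the list `l₁, …, lₙ`. -/
def chain : Clause V → List (Literal V) → Clause V → CNF V
  | P, [], E => {P ∪ E}
  | P, l :: L, E => insert (insert l P) (chain {neg l} L E)

theorem mem_of_mem_chain {L : List (Literal V)} {E : Clause V} {C : Clause V} {q : Literal V} :
    ∀ {P : Clause V}, C ∈ chain P L E → q ∈ C → q ∈ P ∨ q ∈ E ∨ q ∈ L ∨ neg q ∈ L := by
  induction L with
  | nil =>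
    intro P hC hq
    obtain rfl := Finset.mem_singleton.1 hC
    rcases Finset.mem_union.1 hq with h | h <;> simp [h]
  | cons l L ih =>
    intro P hC hq
    rcases Finset.mem_insert.1 hC with rfl | hC
    · rcases Finset.mem_insert.1 hq with h | h <;> simp [h]
    · rcases ih hC hq with h | h | h | h
      · rw [Finset.mem_singleton] at h
        simp [h]
      all_goals simp [h]

theorem exists_mem_chain {L : List (Literal V)} {E : Clause V} {q : Literal V} (hq : q ∈ L) :
    ∀ {P : Clause V}, ∃ C ∈ chain P L E, q ∈ C := by
  induction L with
  | nil => simp at hq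
  | cons l L ih =>
    intro P
    rcases List.mem_cons.1 hq with rfl | hq
    · exact ⟨_, Finset.mem_insert_self _ _, by simp⟩
    · obtain ⟨C, hC, h⟩ := ih hq (P := {neg l})
      exact ⟨C, Finset.mem_insert_of_mem hC, h⟩

/-- Unit propagation: with `P` false, the literals of `L` are forced true in turn, until the last
clause fails. The second alternative in `hE` accounts for literals of `E` whose complements have
already been forced. -/
theorem not_satisfies_chain {τ : V → Bool} {L : List (Literal V)} {E : Clause V}
    (hE : ∀ e ∈ E, neg e ∈ L ∨ τ e.1 ≠ e.2) :
    ∀ {P : Clause V}, (∀ p ∈ P, τ p.1 ≠ p.2) → ¬ Satisfies τ (chain P L E) := by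
  induction L with
  | nil =>
    intro P hP h
    obtain ⟨l, hl, hτ⟩ := h _ (Finset.mem_singleton_self _)
    rcases Finset.mem_union.1 hl with hl | hl
    · exact hP l hl hτ
    · exact (hE l hl).elim (by simp) (· hτ)
  | cons l L ih =>
    intro P hP h
    obtain ⟨p, hp, hτ⟩ := h _ (Finset.mem_insert_self _ _)
    have hl : τ l.1 = l.2 := by
      rcases Finset.mem_insert.1 hp with rfl | hp
      · exact hτ
      · exact absurd hτ (hP p hp)
    have hl' : τ (neg l).1 ≠ (neg l).2 := by simp [neg, hl]
    refine ih ?_ ?_ (h.mono (Finset.subset_insert _ _))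
    · intro e he
      rcases hE e he with h | h
      · rcases List.mem_cons.1 h with h | h
        · right
          rwa [← h, neg_neg] at hl'
        · exact Or.inl h
      · exact Or.inr h
    · simpa using hl'

theorem satisfies_chain {τ : V → Bool} {L : List (Literal V)} {E : Clause V} :
    ∀ {P : Clause V}, (∃ p ∈ P, τ p.1 = p.2) → (∀ l ∈ L, τ l.1 ≠ l.2) →
      Satisfies τ (chain P L E) := by
  induction L with
  | nil =>
    rintro P ⟨p, hp, h⟩ - C hC
    obtain rfl := Finset.mem_singleton.1 hC
    exact ⟨p, Finset.mem_union_left _ hp, h⟩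
  | cons l L ih =>
    rintro P ⟨p, hp, h⟩ hL C hC
    rcases Finset.mem_insert.1 hC with rfl | hC
    · exact ⟨p, Finset.mem_insert_of_mem hp, h⟩
    · refine ih ⟨neg l, by simp, ?_⟩ (fun l' hl' => hL l' (by simp [hl'])) C hC
      have := hL l (by simp)
      revert this
      simp only [neg]
      cases τ l.1 <;> cases l.2 <;> simp

/-- Every assignment can be changed on the variables of `L` so that all literals of `L` become
false. -/
theorem exists_falsifying (τ : V → Bool) (L : List (Literal V)) (hL : (L.map Prod.fst).Nodup) :
    ∃ τ' : V → Bool, (∀ v, v ∉ L.map Prod.fst → τ' v = τ v) ∧ ∀ l ∈ L, τ' l.1 ≠ l.2 := by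
  induction L with
  | nil => exact ⟨τ, by simp, by simp⟩
  | cons l L ih =>
    rw [List.map_cons, List.nodup_cons] at hL
    obtain ⟨τ', h₁, h₂⟩ := ih hL.2
    refine ⟨Function.update τ' l.1 (!l.2), ?_, ?_⟩
    · intro v hv
      rw [List.map_cons, List.mem_cons, not_or] at hv
      rw [Function.update_of_ne hv.1, h₁ v hv.2]
    · intro l' hl'
      rcases List.mem_cons.1 hl' with rfl | hl'
      · simp
      · rw [Function.update_of_ne]
        · exact h₂ l' hl'
        · intro h
          exact hL.1 (h ▸ List.mem_map_of_mem hl')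

/-- The deleted clause interrupts propagation: the literals before it are made true, those after it
false. Agreement with `τ` off `L` protects the choices made earlier in the induction. -/
theorem exists_satisfies_chain_erase {L : List (Literal V)} {E : Clause V} {C : Clause V} :
    ∀ {P : Clause V} (τ : V → Bool), (L.map Prod.fst).Nodup → C ∈ chain P L E →
      ∃ τ' : V → Bool, (∀ v, v ∉ L.map Prod.fst → τ' v = τ v) ∧
        Satisfies τ' ((chain P L E).erase C) := by
  induction L with
  | nil =>
    intro P τ _ hC
    refine ⟨τ, fun _ _ => rfl, fun D hD => ?_⟩
    obtain rfl := Finset.mem_singleton.1 hC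
    simp [chain] at hD
  | cons l L ih =>
    intro P τ hL hC
    rw [List.map_cons, List.nodup_cons] at hL
    by_cases hCl : C = insert l P
    · obtain ⟨τ', h₁, h₂⟩ := exists_falsifying (Function.update τ l.1 (!l.2)) L hL.2
      refine ⟨τ', ?_, ?_⟩
      · intro v hv
        rw [List.map_cons, List.mem_cons, not_or] at hv
        rw [h₁ v hv.2, Function.update_of_ne hv.1]
      · refine (satisfies_chain (P := {neg l}) (E := E) ⟨neg l, by simp, ?_⟩ h₂).mono ?_
        · change τ' l.1 = !l.2
          rw [h₁ _ hL.1, Function.update_self]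
        · rw [hCl, chain]
          intro D hD
          rw [Finset.mem_erase, Finset.mem_insert] at hD
          exact hD.2.resolve_left hD.1
    · obtain ⟨τ', h₁, h₂⟩ := ih (Function.update τ l.1 l.2) hL.2
        ((Finset.mem_insert.1 hC).resolve_left hCl)
      refine ⟨τ', ?_, ?_⟩
      · intro v hv
        rw [List.map_cons, List.mem_cons, not_or] at hv
        rw [h₁ v hv.2, Function.update_of_ne hv.1]
      · intro D hD
        rw [Finset.mem_erase, chain, Finset.mem_insert] at hD
        rcases hD with ⟨hDC, rfl | hD⟩
        · exact ⟨l, by simp, by rw [h₁ _ hL.1, Function.update_self]⟩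
        · exact h₂ D (Finset.mem_erase.2 ⟨hDC, hD⟩)

omit [DecidableEq V] in
theorem neg_notMem_of_nodup {L : List (Literal V)} {l : Literal V}
    (hL : (L.map Prod.fst).Nodup) (hl : l ∈ L) : neg l ∉ L := by
  intro h
  have := List.inj_on_of_nodup_map hL hl h rfl
  have := congrArg Prod.snd this
  simp [neg] at this

/-- No clause repeats, since the literal `l` introduced by one clause occurs in no later clause. -/
theorem card_chain {L : List (Literal V)} {E : Clause V} :
    ∀ {P : Clause V}, (L.map Prod.fst).Nodup → (∀ l ∈ L, l ∉ E) →
      (chain P L E).card = L.length + 1 := by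
  induction L with
  | nil => intros; rfl
  | cons l L ih =>
    intro P hL hE
    have hL' := List.nodup_cons.1 (List.map_cons ▸ hL)
    rw [chain, Finset.card_insert_of_notMem, ih hL'.2 fun l' hl' => hE l' (by simp [hl'])]
    · rfl
    · intro h
      rcases mem_of_mem_chain h (Finset.mem_insert_self l P) with h | h | h | h
      · have := congrArg Prod.snd (Finset.mem_singleton.1 h)
        simp [neg] at this
      · exact hE l (by simp) h
      · exact hL'.1 (List.mem_map_of_mem h)
      · exact hL'.1 (List.mem_map_of_mem (f := Prod.fst) h :)

theorem chain_mUk_one {L : List (Literal V)} {E : Clause V} (hL : (L.map Prod.fst).Nodup)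
    (hE : ∀ e ∈ E, neg e ∈ L) : MUk 1 (chain ∅ L E) := by
  refine ⟨⟨?_, ?_⟩, ?_⟩
  · rintro ⟨τ, hτ⟩
    exact not_satisfies_chain (fun e he => Or.inl (hE e he)) (by simp) hτ
  · intro Ψ hΨ
    obtain ⟨C, hC, hΨC⟩ := Finset.ssubset_iff_exists_subset_erase.1 hΨ
    obtain ⟨τ, -, hτ⟩ := exists_satisfies_chain_erase (fun _ => true) hL hC
    exact ⟨τ, hτ.mono hΨC⟩
  · have hv : vars (chain ∅ L E) = (L.map Prod.fst).toFinset := by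
      ext v
      rw [mem_vars, List.mem_toFinset, List.mem_map]
      constructor
      · rintro ⟨C, hC, b, hb⟩
        rcases mem_of_mem_chain hC hb with h | h | h | h
        · simp at h
        · exact ⟨_, hE _ h, rfl⟩
        · exact ⟨_, h, rfl⟩
        · exact ⟨_, h, rfl⟩
      · rintro ⟨l, hl, rfl⟩
        obtain ⟨C, hC, h⟩ := exists_mem_chain hl (P := ∅) (E := E)
        exact ⟨C, hC, l.2, h⟩
    unfold deficiency
    rw [hv, List.toFinset_card_of_nodup hL, List.length_map,
      card_chain hL fun l hl h => neg_notMem_of_nodup hL hl (hE l h)]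
    push_cast
    ring

theorem image_erase_chain {l : Literal V} {L : List (Literal V)} {E : Clause V}
    (hl : l ∉ L) (hn : neg l ∉ L) : ∀ {P : Clause V},
      (chain P L E).image (fun C => C.erase l) = chain (P.erase l) L (E.erase l) := by
  induction L with
  | nil =>
    intro P
    simp [chain, Finset.erase_union_distrib]
  | cons k L ih =>
    intro P
    simp only [List.mem_cons, not_or] at hl hn
    have hk : neg k ≠ l := fun h => hn.1 (by rw [← h, neg_neg])
    rw [chain, chain, Finset.image_insert, ih hl.2 hn.2, Finset.erase_insert_of_ne (Ne.symm hl.1),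
      Finset.erase_eq_of_notMem (a := l) (s := {neg k}) (by simpa using hk.symm)]

/-! ### Walks in the implication graph -/

/-- The edges of the implication graph: `A` contains the clause `¬ a ∨ b`. -/
def Implies (A : CNF V) (a b : Literal V) : Prop := ({neg a, b} : Clause V) ∈ A

theorem Implies.symm {A : CNF V} {a b : Literal V} (h : Implies A a b) :
    Implies A (neg b) (neg a) := by
  unfold Implies at *
  rwa [neg_neg, Finset.pair_comm]

theorem reflTransGen_implies_symm {A : CNF V} {a b : Literal V}
    (h : Relation.ReflTransGen (Implies A) a b) :
    Relation.ReflTransGen (Implies A) (neg b) (neg a) := by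
  induction h with
  | refl => exact .refl
  | tail _ h ih => exact ih.head h.symm

/-- Clauses with one or two literals, written as implications, that hold along walks. -/
def HasWalk (A : CNF V) (C : Clause V) : Prop :=
  ∃ a b : Literal V, C = {neg a, b} ∧ Relation.ReflTransGen (Implies A) a b

theorem HasWalk.mono {A B : CNF V} (h : A ⊆ B) {C : Clause V} (hC : HasWalk A C) :
    HasWalk B C := by
  obtain ⟨a, b, rfl, hw⟩ := hC
  exact ⟨a, b, rfl, hw.lift id fun _ _ h' => h h'⟩

theorem HasWalk.exists_of_mem {A : CNF V} {C : Clause V} {l : Literal V} (h : HasWalk A C)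
    (hl : l ∈ C) : ∃ a, C = {neg a, l} ∧ Relation.ReflTransGen (Implies A) a l := by
  obtain ⟨a, b, rfl, hw⟩ := h
  simp only [Finset.mem_insert, Finset.mem_singleton] at hl
  rcases hl with rfl | rfl
  · exact ⟨neg b, by rw [neg_neg, Finset.pair_comm], reflTransGen_implies_symm hw⟩
  · exact ⟨a, rfl, hw⟩

/-- Walks are joined at the pivot. If one parent is a unit, its walk joins the two literals of the
pivot, and the walk of the other parent is run before it and, contraposed, after it. -/
theorem HasWalk.resolvent {A : CNF V} {C D R : Clause V} {x : V} (hC : HasWalk A C)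
    (hD : HasWalk A D) (hR : IsResolvent x C D R) (hne : R ≠ ∅) : HasWalk A R := by
  obtain ⟨h₁, h₂, rfl⟩ := hR
  obtain ⟨a, rfl, ha⟩ := hC.exists_of_mem h₁
  obtain ⟨b, rfl, hb⟩ := hD.exists_of_mem h₂
  have hb' : Relation.ReflTransGen (Implies A) (x, true) (neg b) := reflTransGen_implies_symm hb
  have e₁ : ∀ c d : Literal V, ({c, d} : Clause V).erase d = if c = d then ∅ else {c} := by
    intro c d
    split_ifs with h
    · simp [h]
    · rw [Finset.erase_insert_of_ne h]; simp
  rw [e₁, e₁] at hne ⊢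
  split_ifs at hne ⊢ with ha' hb'' hb''
  · simp at hne
  · refine ⟨b, neg b, by simp, ?_⟩
    refine hb.trans ?_
    have hax : a = (x, false) := by rw [← neg_neg a, ha']; rfl
    exact (hax ▸ ha).trans hb'
  · refine ⟨a, neg a, by simp, ?_⟩
    have hbx : neg b = (x, false) := hb''
    have : Relation.ReflTransGen (Implies A) (x, false) (neg a) := reflTransGen_implies_symm ha
    exact (ha.trans (hbx ▸ hb')).trans this
  · exact ⟨a, neg b, rfl, ha.trans hb'⟩

theorem hasWalk_singleton {C : Clause V} (h : C.card ≤ 2) (hne : C ≠ ∅) : HasWalk {C} C := by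
  have : ∃ a b : Literal V, C = {a, b} := by
    have h₁ : C.card ≠ 0 := by simpa using hne
    obtain h | h : C.card = 1 ∨ C.card = 2 := by omega
    · obtain ⟨a, rfl⟩ := Finset.card_eq_one.1 h
      exact ⟨a, a, by simp⟩
    · obtain ⟨a, b, -, rfl⟩ := Finset.card_eq_two.1 h
      exact ⟨a, b, rfl⟩
  obtain ⟨a, b, rfl⟩ := this
  exact ⟨neg a, b, by simp, .single (by simp [Implies])⟩

/-- The walk may use a clause repeatedly, so only the set of leaves is recorded. -/
theorem TreeDerives.hasWalk {A : Multiset (Clause V)} {C : Clause V} (h : TreeDerives A C) :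
    (∀ D ∈ A, D.card ≤ 2 ∧ D ≠ ∅) → C ≠ ∅ → HasWalk A.toFinset C := by
  induction h with
  | leaf C =>
    intro hA hC
    simpa using hasWalk_singleton (hA C (by simp)).1 hC
  | @res A B C D R _ _ hR ih₁ ih₂ =>
    intro hA hne
    have hC : C ≠ ∅ := by
      rintro rfl
      obtain ⟨x, h | h⟩ := hR
      · simpa using h.1
      · simpa using h.2.1
    have hD : D ≠ ∅ := by
      rintro rfl
      obtain ⟨x, h | h⟩ := hR
      · simpa using h.2.1
      · simpa using h.1
    have h₁ : HasWalk (A + B).toFinset C :=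
      (ih₁ (fun E hE => hA E (by simp [hE])) hC).mono (by simp)
    have h₂ : HasWalk (A + B).toFinset D :=
      (ih₂ (fun E hE => hA E (by simp [hE])) hD).mono (by simp)
    obtain ⟨x, h | h⟩ := hR
    · exact h₁.resolvent h₂ h hne
    · exact h₂.resolvent h₁ h hne

/-! ### Lassos and the splitting they define -/

/-- From `s` a path runs over the literals of `L`, whose variables are distinct, and from its end
there is an edge to the complement of a literal on the path. -/
def IsLasso (A : CNF V) (s : Literal V) (L : List (Literal V)) (u : Literal V) : Prop :=
  ((s :: L).map Prod.fst).Nodup ∧ neg u ∈ s :: L ∧ chain {neg s} L {u} ⊆ A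

theorem chain_subset_of_isChain {A : CNF V} {u : Literal V} {L : List (Literal V)} :
    ∀ {s : Literal V}, (s :: L).IsChain (Implies A) →
      Implies A ((s :: L).getLast (by simp)) u → chain {neg s} L {u} ⊆ A := by
  induction L with
  | nil =>
    intro s _ h C hC
    obtain rfl := Finset.mem_singleton.1 hC
    exact h
  | cons l L ih =>
    intro s hs h
    rw [List.isChain_cons_cons] at hs
    rw [chain, Finset.insert_subset_iff]
    refine ⟨?_, ih hs.2 (by simpa using h)⟩
    rw [Finset.pair_comm]
    exact hs.1

/-- Along the walk a path with distinct variables is maintained: a literal seen before cuts the path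
back to it, a literal whose complement was seen closes a lasso, and a new variable extends the path.
-/
theorem exists_isLasso_or_path {A : CNF V} {s t : Literal V}
    (h : Relation.ReflTransGen (Implies A) s t) :
    (∃ L u, IsLasso A s L u) ∨ ∃ L : List (Literal V), ((s :: L).map Prod.fst).Nodup ∧
      (s :: L).IsChain (Implies A) ∧ (s :: L).getLast (by simp) = t := by
  induction h with
  | refl => exact Or.inr ⟨[], by simp⟩
  | @tail t u _ htu ih =>
    rcases ih with ih | ⟨L, hnd, hch, hlast⟩
    · exact Or.inl ih
    by_cases hneg : neg u ∈ s :: L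
    · exact Or.inl ⟨L, u, hnd, hneg, chain_subset_of_isChain hch (hlast ▸ htu)⟩
    right
    by_cases hmem : u ∈ s :: L
    · obtain ⟨L₁, L₂, hL⟩ := List.append_of_mem hmem
      have hpre : L₁ ++ [u] <+: s :: L := ⟨L₂, by simp [hL]⟩
      cases L₁ with
      | nil =>
        obtain ⟨rfl, -⟩ := List.cons.inj hL
        exact ⟨[], by simp⟩
      | cons s' L₁ =>
        obtain ⟨rfl, -⟩ := List.cons.inj hL
        exact ⟨L₁ ++ [u], (hpre.sublist.map _).nodup hnd, hch.prefix hpre, by simp⟩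
    · refine ⟨L ++ [u], ?_, ?_, by simp⟩
      · have : u.1 ∉ (s :: L).map Prod.fst := by
          intro h
          obtain ⟨⟨v, b⟩, hl, rfl⟩ := List.mem_map.1 h
          obtain ⟨u₁, u₂⟩ := u
          by_cases hb : b = u₂
          · exact hmem (by simpa [hb] using hl)
          · have : b = !u₂ := by revert hb; cases b <;> cases u₂ <;> simp
            exact hneg (by simpa [neg, this] using hl)
        rw [← List.cons_append, List.map_append, List.nodup_append]
        refine ⟨hnd, by simp, ?_⟩
        intro a ha b hb hab
        simp only [List.map_cons, List.map_nil, List.mem_singleton] at hb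
        exact this (hb ▸ hab ▸ ha)
      · rw [← List.cons_append, List.isChain_append]
        refine ⟨hch, by simp, ?_⟩
        intro a ha b hb
        rw [List.getLast?_eq_getLast_of_ne_nil (by simp), hlast] at ha
        simp only [Option.mem_some_iff, List.head?_cons] at ha hb
        exact ha ▸ hb ▸ htu

theorem exists_isLasso {A : CNF V} {s : Literal V}
    (h : Relation.ReflTransGen (Implies A) s (neg s)) : ∃ L u, IsLasso A s L u := by
  rcases exists_isLasso_or_path h with h | ⟨L, hnd, -, hlast⟩
  · exact h
  · have hm : neg s ∈ s :: L := by
      rw [← hlast]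
      exact List.getLast_mem _
    exact absurd hm (neg_notMem_of_nodup hnd (by simp))

/-- Stripping the clauses of a lasso starting at `¬ l` of the literal `l` gives a minimal
unsatisfiable formula of deficiency 1, and `¬ l` does not occur in these clauses. -/
theorem IsLasso.strip {A : CNF V} {l : Literal V} {L : List (Literal V)} {u : Literal V}
    (h : IsLasso A (neg l) L u) :
    MUk 1 ((chain {l} L {u}).image fun C => C.erase l) ∧ ∀ C ∈ chain {l} L {u}, neg l ∉ C := by
  obtain ⟨hnd, hu, -⟩ := h
  have hnd' := List.nodup_cons.1 (List.map_cons ▸ hnd)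
  have hl : l ∉ L := fun h => hnd'.1 (List.mem_map_of_mem (f := Prod.fst) h :)
  have hn : neg l ∉ L := fun h => hnd'.1 (List.mem_map_of_mem (f := Prod.fst) h :)
  constructor
  · rw [image_erase_chain hl hn]
    have : ({l} : Clause V).erase l = ∅ := by simp
    rw [this]
    refine chain_mUk_one hnd'.2 fun e he => ?_
    obtain ⟨hel, he⟩ := Finset.mem_erase.1 he
    obtain rfl := Finset.mem_singleton.1 he
    refine (List.mem_cons.1 hu).resolve_left fun h => hel ?_
    rw [← neg_neg e, h, neg_neg]
  · intro C hC hnC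
    have hne : neg l ≠ l := fun h => by
      have := congrArg Prod.snd h
      simp [neg] at this
    rcases mem_of_mem_chain hC hnC with h | h | h | h
    · exact hne (Finset.mem_singleton.1 h)
    · rw [← Finset.mem_singleton.1 h, neg_neg] at hu
      rcases List.mem_cons.1 hu with h | h
      · exact hne h.symm
      · exact hl h
    · exact hn h
    · exact hl (by simpa using h)

theorem stripped_union_filter {Φ A B : CNF V} {l : Literal V} (hΦ : Φ = A ∪ B)
    (hB : ∀ C ∈ B, l ∉ C) :
    stripped Φ l ∪ A.filter (fun C => l ∉ C) = A.image fun C => C.erase l := by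
  subst hΦ
  ext D
  simp only [stripped, Finset.mem_union, Finset.mem_image, Finset.mem_filter]
  constructor
  · rintro (⟨C, ⟨hC | hC, hl⟩, rfl⟩ | ⟨hD, hl⟩)
    · exact ⟨C, hC, rfl⟩
    · exact absurd hl (hB C hC)
    · exact ⟨D, hD, Finset.erase_eq_of_notMem hl⟩
  · rintro ⟨C, hC, rfl⟩
    by_cases hl : l ∈ C
    · exact Or.inl ⟨C, ⟨Or.inl hC, hl⟩, rfl⟩
    · rw [Finset.erase_eq_of_notMem hl]
      exact Or.inr ⟨hC, hl⟩

theorem exists_disjunctive_splitting_of_isLasso {A B : CNF V} {x : V} {L M : List (Literal V)}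
    {u w : Literal V} (hA : IsLasso A (x, false) L u) (hB : IsLasso B (x, true) M w)
    (hAB : Disjoint A B) :
    ∃ Φ' ⊆ A ∪ B, ∃ F G : CNF V, IsDisjunctiveSplitting Φ' x F G ∧ MUk 1 F ∧ MUk 1 G := by
  have hAsub : chain {(x, true)} L {u} ⊆ A := hA.2.2
  have hBsub : chain {(x, false)} M {w} ⊆ B := hB.2.2
  obtain ⟨hF, hA'⟩ := IsLasso.strip (l := (x, true)) hA
  obtain ⟨hG, hB'⟩ := IsLasso.strip (l := (x, false)) hB
  simp only [neg, Bool.not_true, Bool.not_false] at hA' hB'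
  set A' := chain {(x, true)} L {u}
  set B' := chain {(x, false)} M {w}
  -- Only the clauses of the two lassos are kept. Those of `A'` avoid `¬x` and those of `B'` avoid
  -- `x`, so each stripped set comes from one lasso alone.
  refine ⟨A' ∪ B', Finset.union_subset_union hAsub hBsub, _, _,
    ⟨A'.filter (fun C => (x, true) ∉ C), B'.filter (fun C => (x, false) ∉ C),
      ⟨?_, ?_, (stripped_union_filter rfl hB').symm, ?_, hF.1, hG.1⟩, ?_⟩, hF, hG⟩
  · intro C hC
    have hC := Finset.mem_filter.1 hC
    exact Finset.mem_filter.2 ⟨Finset.mem_union_left _ hC.1, hC.2, hA' C hC.1⟩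
  · intro C hC
    have hC := Finset.mem_filter.1 hC
    exact Finset.mem_filter.2 ⟨Finset.mem_union_right _ hC.1, hB' C hC.1, hC.2⟩
  · rw [Finset.union_comm (B'.filter _)]
    exact (stripped_union_filter (Finset.union_comm _ _) hA').symm
  · exact Finset.disjoint_iff_inter_eq_empty.1
      ((hAB.mono hAsub hBsub).mono (Finset.filter_subset _ _) (Finset.filter_subset _ _))

theorem exists_lassos_of_treeDerives {A : CNF V} (h : TreeDerives A.val ∅)
    (hA : ∀ C ∈ A, C.card ≤ 2 ∧ C ≠ ∅) :
    ∃ (x : V) (B C : CNF V), B ∪ C ⊆ A ∧ Disjoint B C ∧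
      (∃ L u, IsLasso B (x, false) L u) ∧ ∃ L u, IsLasso C (x, true) L u := by
  -- As `∅` is not a leaf, the root is a resolvent, and its parents must be complementary unit
  -- clauses.
  have hroot : ∃ (x : V) (S T : Multiset (Clause V)), S + T = A.val ∧
      TreeDerives S {(x, true)} ∧ TreeDerives T {(x, false)} := by
    have hpar : ∀ {x : V} {C D : Clause V}, IsResolvent x C D ∅ →
        C = {(x, true)} ∧ D = {(x, false)} := by
      rintro x C D ⟨h₁, h₂, h⟩
      obtain ⟨hC, hD⟩ := Finset.union_eq_empty.1 h.symm
      exact ⟨((Finset.erase_eq_empty_iff _ _).1 hC).resolve_left (Finset.ne_empty_of_mem h₁),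
        ((Finset.erase_eq_empty_iff _ _).1 hD).resolve_left (Finset.ne_empty_of_mem h₂)⟩
    generalize hN : A.val = N at h
    cases h with
    | leaf =>
      have : (∅ : Clause V) ∈ A := by
        rw [← Finset.mem_val, hN]; simp
      exact absurd rfl (hA _ this).2
    | @res S T C D _ h₁ h₂ hR =>
      obtain ⟨x, hR | hR⟩ := hR <;> obtain ⟨rfl, rfl⟩ := hpar hR
      · exact ⟨x, S, T, rfl, h₁, h₂⟩
      · exact ⟨x, T, S, add_comm _ _, h₂, h₁⟩
  obtain ⟨x, S, T, hST, hS, hT⟩ := hroot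
  have hmem : ∀ C, C ∈ S ∨ C ∈ T → C ∈ A := fun C hC => by
    rw [← Finset.mem_val, ← hST]
    exact Multiset.mem_add.2 hC
  have hwS := hS.hasWalk (fun C hC => hA C (hmem C (Or.inl hC))) (by simp)
  have hwT := hT.hasWalk (fun C hC => hA C (hmem C (Or.inr hC))) (by simp)
  have hwalk : ∀ {B : CNF V} {l : Literal V}, HasWalk B {l} →
      Relation.ReflTransGen (Implies B) (neg l) (neg (neg l)) := by
    intro B l h
    obtain ⟨a, ha, hw⟩ := h.exists_of_mem (Finset.mem_singleton_self l)
    have : neg a ∈ ({l} : Clause V) := by rw [ha]; simp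
    rw [← Finset.mem_singleton.1 this, neg_neg]
    rwa [Finset.mem_singleton.1 this]
  refine ⟨x, S.toFinset, T.toFinset, ?_, ?_, exists_isLasso (hwalk hwS),
    exists_isLasso (hwalk hwT)⟩
  · intro C hC
    rw [Finset.mem_union, Multiset.mem_toFinset, Multiset.mem_toFinset] at hC
    exact hmem C hC
  · have hnd := A.nodup
    rw [← hST, Multiset.nodup_add] at hnd
    exact Multiset.disjoint_toFinset.2 hnd.2.2

end ReadOnce

theorem mainTheorem5 {V : Type*} [DecidableEq V] (Φ : ReadOnce.CNF V)
    (h2 : ReadOnce.Is2CNF Φ) (hne : (∅ : ReadOnce.Clause V) ∉ Φ) :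
    ReadOnce.ROR Φ ↔
      ∃ Φ' : ReadOnce.CNF V, Φ' ⊆ Φ ∧ ∃ (x : V) (F G : ReadOnce.CNF V),
        ReadOnce.IsDisjunctiveSplitting Φ' x F G ∧ ReadOnce.MUk 1 F ∧ ReadOnce.MUk 1 G := by
  constructor
  · intro h
    obtain ⟨A, hA, hT⟩ := ReadOnce.ReadOnceDerives.exists_treeDerives h
    obtain ⟨x, B, C, hBC, hd, ⟨L, u, hL⟩, M, w, hM⟩ := ReadOnce.exists_lassos_of_treeDerives hT
      fun C hC => ⟨h2 C (hA hC), fun h => hne (h ▸ hA hC)⟩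
    obtain ⟨Φ', hΦ', F, G, h⟩ := ReadOnce.exists_disjunctive_splitting_of_isLasso hL hM hd
    exact ⟨Φ', hΦ'.trans (hBC.trans hA), x, F, G, h⟩
  · rintro ⟨Φ', hsub, x, F, G, h, hF, hG⟩
    exact ReadOnce.ror_of_disjunctive_splitting h2 hsub h hF hG
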